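/- Let $H$ be a complex Hilbert space and let $T$ be a densely defined closed linear operator in $H$ with domain $D(T)$. Assume that $T$ is totally paranormal, that is, for every $\lambda\in\mathbb C$ and every $x$ in the domain of $(T-\lambda I)^2$, $$\|(T-\lambda I)x\|^2\le \|(T-\lambda I)^2x\|\,\|x\|.$$ Let $\sigma(T)$ be the set of all $z\in\mathbb C$ for which $T-zI:D(T)\to H$ has no everywhere defined bounded inverse. (a) Let $\mu$ be an isolated point of $\sigma(T)$, and let $r>0$ be any radius with $\{z\in\mathbb C:|z-\mu|\le r\}\cap\sigma(T)=\{\mu\}$. Then the integral defining the Riesz projection $$E_\mu=\frac1{2\pi i}\int_{|z-\mu|=r}(zI-T)^{-1}\,dz$$ (over the positively oriented circle) exists in the space $B(H)$ of bounded linear operators on $H$, with its operator norm, and the kernel of $E_\mu$ is the range of $T-\mu I$: $$N(E_\mu)=\operatorname{ran}(T-\mu I).$$ (b) If $0$ is an isolated point of $\sigma(T)$, then $\operatorname{ran}(T)$ is closed. -/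

import Mathlib

/-! Unbounded operators on a complex Hilbert space `H` are modelled by Mathlib's partially defined
linear maps `H →ₗ.[ℂ] H`. -/

namespace UnboundedOperator

noncomputable section

variable {H : Type*} [NormedAddCommGroup H] [InnerProductSpace ℂ H]

/-- The operator `T - c I`, with the same domain as `T`. -/
def subScalar (T : H →ₗ.[ℂ] H) (c : ℂ) : H →ₗ.[ℂ] H where
  domain := T.domain
  toFun := T.toFun - c • T.domain.subtype

/-- The range of an operator. -/
def ran (S : H →ₗ.[ℂ] H) : Submodule ℂ H := LinearMap.range S.toFun

/-- `S` is paranormal: `‖S x‖² ≤ ‖S² x‖ ‖x‖` for all `x` in the domain of `S²`, that is, for all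
`x` in the domain of `S` such that `S x` is again in the domain of `S`. -/
def IsParanormal (S : H →ₗ.[ℂ] H) : Prop :=
  ∀ (x : S.domain) (hx : S x ∈ S.domain), ‖S x‖ ^ 2 ≤ ‖S ⟨S x, hx⟩‖ * ‖(x : H)‖

/-- `T` is totally paranormal: `T - c I` is paranormal for every complex number `c`. -/
def IsTotallyParanormal (T : H →ₗ.[ℂ] H) : Prop :=
  ∀ c : ℂ, IsParanormal (subScalar T c)

/-- `R` is an everywhere defined bounded inverse of `S`: it maps `H` into the domain of `S`,
`S R = I` on `H`, and `R S = I` on the domain of `S`. -/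
def IsBoundedInverse (S : H →ₗ.[ℂ] H) (R : H →L[ℂ] H) : Prop :=
  (∀ y : H, ∃ hy : R y ∈ S.domain, S ⟨R y, hy⟩ = y) ∧ ∀ x : S.domain, R (S x) = x

/-- The resolvent set: all `z` such that `T - z I` is invertible with inverse in `B(H)`. -/
def resolventSet (T : H →ₗ.[ℂ] H) : Set ℂ :=
  {z | ∃ R : H →L[ℂ] H, IsBoundedInverse (subScalar T z) R}

/-- The spectrum: the complement of the resolvent set. -/
def spectrum (T : H →ₗ.[ℂ] H) : Set ℂ := (resolventSet T)ᶜ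

/-- `μ` is an isolated point of the set `s`. -/
def IsIsolatedPoint (s : Set ℂ) (μ : ℂ) : Prop :=
  μ ∈ s ∧ ∃ U : Set ℂ, IsOpen U ∧ U ∩ s = {μ}

open Classical in
/-- The inverse `S⁻¹` in `B(H)` of an operator `S` that has one, and `0` otherwise. -/
def boundedInverse (S : H →ₗ.[ℂ] H) : H →L[ℂ] H :=
  if h : ∃ R : H →L[ℂ] H, IsBoundedInverse S R then h.choose else 0

/-- The resolvent `(z I - T)⁻¹`, meant for `z` in the resolvent set of `T`. -/
def resolvent (T : H →ₗ.[ℂ] H) (z : ℂ) : H →L[ℂ] H := boundedInverse (-subScalar T z)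

/-- The Riesz projection `E_μ = (1 / 2πi) ∫ (z I - T)⁻¹ dz` over the circle `|z - μ| = r`,
a Bochner integral in `B(H)`. It is meant for `r > 0` such that the closed disc
`|z - μ| ≤ r` meets the spectrum of `T` exactly in `μ`. -/
def rieszProjection (T : H →ₗ.[ℂ] H) (μ : ℂ) (r : ℝ) : H →L[ℂ] H :=
  (2 * Real.pi * Complex.I : ℂ)⁻¹ • circleIntegral (resolvent T) μ r

end

end UnboundedOperator

namespace UnboundedOperator

open Metric Filter Topology

/-! ### Resolvent identities and holomorphy -/

section Resolvent

variable {H : Type*} [NormedAddCommGroup H] [InnerProductSpace ℂ H]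

/-! Put `Bₙ = (1/2πi) ∮ (z - μ)ⁿ (z - T)⁻¹ dz`, so `B₀ = E_μ`; then `(T - μ) Bₙ = Bₙ₊₁ - δₙ,₋₁`
(`subScalar_resolventMoment`). Hence `Bₙ = (T - μ)ⁿ E_μ` for `n ≥ 0`, and paranormality makes `‖Bₙ
y‖` log-convex: if `B₁ y ≠ 0`, it grows at least like `c qⁿ` with `q > 0`. But the circle can be
shrunk, so `‖Bₙ‖ ≤ C εⁿ` for every small `ε`. Thus `(T - μ) E_μ = B₁ = 0`
(`resolventMoment_one_eq_zero`).

As `E_μ` commutes with resolvents, it kills `ran (T - μ)`. Conversely, if `E_μ y = 0`, the case `n =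
-1` reads `(T - μ) B₋₁ y = -y`. For (b), the range is the kernel of a bounded operator. -/

lemma subScalar_apply (T : H →ₗ.[ℂ] H) (c : ℂ) (x : T.domain) :
    subScalar T c x = T x - c • (x : H) := rfl

lemma isBoundedInverse_resolvent {T : H →ₗ.[ℂ] H} {z : ℂ} (hz : z ∈ resolventSet T) :
    IsBoundedInverse (-subScalar T z) (resolvent T z) := by
  have h : ∃ R : H →L[ℂ] H, IsBoundedInverse (-subScalar T z) R := by
    obtain ⟨R, h₁, h₂⟩ := hz
    refine ⟨-R, fun y => ?_, fun x => ?_⟩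
    · obtain ⟨hy, e⟩ := h₁ y
      refine ⟨(subScalar T z).domain.neg_mem hy, ?_⟩
      have : (⟨(-R) y, (subScalar T z).domain.neg_mem hy⟩ : (subScalar T z).domain) =
          -⟨R y, hy⟩ := rfl
      rw [LinearPMap.neg_apply, this, LinearPMap.map_neg, neg_neg, e]
    · have := h₂ x
      simpa [LinearPMap.neg_apply] using this
  rw [resolvent, boundedInverse, dif_pos h]
  exact h.choose_spec

lemma resolvent_apply_mem_domain {T : H →ₗ.[ℂ] H} {z : ℂ} (hz : z ∈ resolventSet T) (y : H) :
    resolvent T z y ∈ T.domain :=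
  ((isBoundedInverse_resolvent hz).1 y).1

lemma apply_resolvent_apply {T : H →ₗ.[ℂ] H} {z : ℂ} (hz : z ∈ resolventSet T) (y : H) :
    T ⟨resolvent T z y, resolvent_apply_mem_domain hz y⟩ = z • resolvent T z y - y := by
  obtain ⟨hy, e⟩ := (isBoundedInverse_resolvent hz).1 y
  have e' : -(T ⟨resolvent T z y, hy⟩ - z • resolvent T z y) = y := e
  rw [neg_eq_iff_eq_neg, sub_eq_iff_eq_add] at e'
  exact e'.trans (by abel)

lemma resolvent_smul_sub_apply {T : H →ₗ.[ℂ] H} {z : ℂ} (hz : z ∈ resolventSet T)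
    (x : T.domain) : resolvent T z (z • (x : H) - T x) = x := by
  have e : resolvent T z (-(T x - z • (x : H))) = x := (isBoundedInverse_resolvent hz).2 x
  rwa [neg_sub] at e

/-- Apply `R(w)(w - T) = 1` on the range of `R(z)`, where `T R(z) = z R(z) - 1`. -/
lemma resolvent_sub_resolvent {T : H →ₗ.[ℂ] H} {z w : ℂ} (hz : z ∈ resolventSet T)
    (hw : w ∈ resolventSet T) :
    resolvent T z - resolvent T w = (w - z) • (resolvent T w * resolvent T z) := by
  ext y
  have h := resolvent_smul_sub_apply hw ⟨resolvent T z y, resolvent_apply_mem_domain hz y⟩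
  rw [apply_resolvent_apply hz] at h
  simp only [map_sub, map_smul] at h
  simp only [sub_apply, smul_apply, mul_apply_eq_comp, sub_smul]
  nth_rewrite 1 [← h]
  abel

lemma resolvent_mul_comm {T : H →ₗ.[ℂ] H} {z w : ℂ} (hz : z ∈ resolventSet T)
    (hw : w ∈ resolventSet T) :
    resolvent T z * resolvent T w = resolvent T w * resolvent T z := by
  rcases eq_or_ne z w with rfl | hne
  · rfl
  · have h₁ := resolvent_sub_resolvent hz hw
    have h₂ := resolvent_sub_resolvent hw hz
    have h : (w - z) • (resolvent T z * resolvent T w) =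
        (w - z) • (resolvent T w * resolvent T z) := by
      rw [← h₁, ← neg_sub z w, neg_smul, ← h₂, neg_sub]
    exact smul_right_injective _ (sub_ne_zero.2 hne.symm) h

lemma differentiableOn_resolvent [CompleteSpace H] (T : H →ₗ.[ℂ] H) :
    DifferentiableOn ℂ (resolvent T) (resolventSet T) := by
  intro w hw
  -- The resolvent identity reads `R(z) g(z) = R(w)`, and `g(z)` is invertible near `w`.
  let g : ℂ → H →L[ℂ] H := fun z => 1 + (z - w) • resolvent T w
  have hg : Differentiable ℂ g := by fun_prop
  have hgw : IsUnit (g w) := by simp [g]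
  have hd : DifferentiableAt ℂ (fun z => resolvent T w * Ring.inverse (g z)) w :=
    ((hg w).inverse hgw).const_mul _
  have hev : ∀ᶠ z in 𝓝 w, IsUnit (g z) :=
    hg.continuous.continuousAt.eventually (Units.isOpen.mem_nhds hgw)
  have key : ∀ z ∈ resolventSet T, IsUnit (g z) →
      resolvent T z = resolvent T w * Ring.inverse (g z) := by
    intro z hz hu
    have h := resolvent_sub_resolvent hw hz
    have h' : resolvent T z * g z = resolvent T w := by
      simp only [g, mul_add, mul_one, mul_smul_comm]
      rw [← h]; abel
    rw [← h', mul_assoc, Ring.mul_inverse_cancel _ hu, mul_one]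
  refine hd.differentiableWithinAt.congr_of_eventuallyEq ?_ (key w hw hgw)
  filter_upwards [self_mem_nhdsWithin, nhdsWithin_le_nhds hev] with z hz hu using key z hz hu

end Resolvent

/-! ### Moments of the resolvent -/

section Moments

variable {H : Type*} [NormedAddCommGroup H] [InnerProductSpace ℂ H]

/-- The Laurent-type coefficients `(1 / 2πi) ∮ (z - μ)ⁿ (z I - T)⁻¹ dz` of the resolvent. -/
noncomputable def resolventMoment (T : H →ₗ.[ℂ] H) (μ : ℂ) (r : ℝ) (n : ℤ) : H →L[ℂ] H :=
  (2 * Real.pi * Complex.I : ℂ)⁻¹ • circleIntegral (fun z => (z - μ) ^ n • resolvent T z) μ r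

lemma resolventMoment_zero (T : H →ₗ.[ℂ] H) (μ : ℂ) (r : ℝ) :
    resolventMoment T μ r 0 = rieszProjection T μ r := by
  simp [resolventMoment, rieszProjection]

variable [CompleteSpace H] {T : H →ₗ.[ℂ] H} {μ : ℂ} {r : ℝ}

lemma continuousOn_zpow_smul_resolvent (n : ℤ) {s : Set ℂ} (hs : s ⊆ resolventSet T)
    (hμ : μ ∉ s) : ContinuousOn (fun z => (z - μ) ^ n • resolvent T z) s := by
  have h : ContinuousOn (fun z : ℂ => (z - μ) ^ n) s :=
    (continuousOn_id.sub continuousOn_const).zpow₀ n fun z hz =>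
      Or.inl (sub_ne_zero.2 fun h => hμ ((show z = μ from h) ▸ hz))
  exact h.smul ((differentiableOn_resolvent T).continuousOn.mono hs)

lemma continuousOn_resolvent_sphere (hs : sphere μ r ⊆ resolventSet T) :
    ContinuousOn (resolvent T) (sphere μ r) :=
  (differentiableOn_resolvent T).continuousOn.mono hs

lemma circleIntegrable_zpow_smul_resolvent (hr : 0 < r) (hs : sphere μ r ⊆ resolventSet T)
    (n : ℤ) : CircleIntegrable (fun z => (z - μ) ^ n • resolvent T z) μ r :=
  (continuousOn_zpow_smul_resolvent n hs (by simp [hr.ne])).circleIntegrable hr.le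

lemma _root_.ContinuousLinearMap.circleIntegral_comp_comm {E F : Type*} [NormedAddCommGroup E]
    [NormedSpace ℂ E] [CompleteSpace E] [NormedAddCommGroup F] [NormedSpace ℂ F] [CompleteSpace F]
    (L : E →L[ℂ] F) {f : ℂ → E} {c : ℂ} {R : ℝ} (hf : CircleIntegrable f c R) :
    circleIntegral (fun z => L (f z)) c R = L (circleIntegral f c R) := by
  simp only [circleIntegral, ← map_smul]
  exact L.intervalIntegral_comp_comm hf.out

lemma resolventMoment_commute (hr : 0 < r) (hs : sphere μ r ⊆ resolventSet T)
    {w : ℂ} (hw : w ∈ resolventSet T) (n : ℤ) :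
    resolventMoment T μ r n * resolvent T w = resolvent T w * resolventMoment T μ r n := by
  have hi := circleIntegrable_zpow_smul_resolvent hr hs n
  have h₁ := ((ContinuousLinearMap.mul ℂ (H →L[ℂ] H)).flip
    (resolvent T w)).circleIntegral_comp_comm hi
  have h₂ := (ContinuousLinearMap.mul ℂ (H →L[ℂ] H) (resolvent T w)).circleIntegral_comp_comm hi
  simp only [ContinuousLinearMap.flip_apply, ContinuousLinearMap.mul_apply'] at h₁ h₂
  rw [resolventMoment, smul_mul_assoc, mul_smul_comm, ← h₁, ← h₂]
  congr 1
  refine circleIntegral.integral_congr hr.le fun z hz => ?_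
  simp only [smul_mul_assoc, mul_smul_comm, resolvent_mul_comm (hs hz) hw]

/-- The relation `(T - μ) Bₙ = Bₙ₊₁ - δₙ,₋₁` between the moments, solved for `Bₙ` by means of the
resolvent at `w`. -/
lemma resolventMoment_eq (hr : 0 < r) (hs : sphere μ r ⊆ resolventSet T)
    {w : ℂ} (hw : w ∈ resolventSet T) (n : ℤ) :
    resolventMoment T μ r n = resolvent T w *
      ((w - μ) • resolventMoment T μ r n - resolventMoment T μ r (n + 1) +
        if n = -1 then 1 else 0) := by
  have hn := circleIntegrable_zpow_smul_resolvent hr hs n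
  have hn' := circleIntegrable_zpow_smul_resolvent hr hs (n + 1)
  have hp : CircleIntegrable (fun z => (z - μ) ^ n • (1 : H →L[ℂ] H)) μ r := by
    have h : ContinuousOn (fun z : ℂ => (z - μ) ^ n) (sphere μ r) :=
      (continuousOn_id.sub continuousOn_const).zpow₀ n fun z hz =>
        Or.inl (sub_ne_zero.2 fun h => by
          simp [show z = μ from h, hr.ne] at hz)
    exact (h.smul continuousOn_const).circleIntegrable hr.le
  have hnw : CircleIntegrable (fun z => (w - μ) • (z - μ) ^ n • resolvent T z) μ r :=
    ((continuousOn_zpow_smul_resolvent n hs (by simp [hr.ne])).const_smul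
      (w - μ)).circleIntegrable hr.le
  have hsub : CircleIntegrable (fun z => (w - μ) • (z - μ) ^ n • resolvent T z -
      (z - μ) ^ (n + 1) • resolvent T z) μ r := hnw.sub hn'
  have hint : circleIntegral (fun z => (z - μ) ^ n • (1 : H →L[ℂ] H)) μ r =
      (2 * Real.pi * Complex.I : ℂ) • if n = -1 then 1 else 0 := by
    rw [circleIntegral.integral_smul_const]
    split_ifs with h
    · subst h
      simp [circleIntegral.integral_sub_center_inv μ hr.ne']
    · rw [circleIntegral.integral_sub_zpow_of_ne h, zero_smul, smul_zero]
  have hI : (2 * Real.pi * Complex.I : ℂ) ≠ 0 := Complex.two_pi_I_ne_zero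
  have key : circleIntegral (fun z => (z - μ) ^ n • resolvent T z) μ r = resolvent T w *
      ((w - μ) • circleIntegral (fun z => (z - μ) ^ n • resolvent T z) μ r -
        circleIntegral (fun z => (z - μ) ^ (n + 1) • resolvent T z) μ r +
        (2 * Real.pi * Complex.I : ℂ) • if n = -1 then 1 else 0) := by
    rw [← hint, ← circleIntegral.integral_smul, ← circleIntegral.integral_sub hnw hn',
      ← circleIntegral.integral_add hsub hp]
    have := (ContinuousLinearMap.mul ℂ (H →L[ℂ] H) (resolvent T w)).circleIntegral_comp_comm
      (hsub.add hp)
    simp only [ContinuousLinearMap.mul_apply', Pi.add_apply] at this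
    refine Eq.trans ?_ this
    refine circleIntegral.integral_congr hr.le fun z hz => ?_
    have hzμ : z - μ ≠ 0 := sub_ne_zero.2 fun h => by simp [h, hr.ne] at hz
    -- Expand `R(z) = R(w) + (w - z) R(w) R(z)` with `w - z = (w - μ) - (z - μ)`.
    have hres := resolvent_sub_resolvent (hs hz) hw
    rw [sub_eq_iff_eq_add] at hres
    simp only [zpow_add_one₀ hzμ, mul_add, mul_sub, mul_smul_comm, mul_one]
    nth_rewrite 1 [hres]
    module
  simp only [resolventMoment]
  nth_rewrite 1 [key]
  rw [← mul_smul_comm, smul_add, smul_sub, smul_smul _ (2 * Real.pi * Complex.I : ℂ),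
    inv_mul_cancel₀ hI, one_smul, smul_comm (w - μ)]

lemma resolventMoment_mem_domain (hr : 0 < r) (hs : sphere μ r ⊆ resolventSet T) (n : ℤ) (y : H) :
    resolventMoment T μ r n y ∈ T.domain := by
  have hw : μ + r ∈ resolventSet T := hs (by simp [abs_of_pos hr])
  rw [resolventMoment_eq hr hs hw n]
  exact resolvent_apply_mem_domain hw _

/-- `T` is applied to the outer factor `R(w)` of `resolventMoment_eq`, so it never has to pass under
the integral. -/
lemma subScalar_resolventMoment (hr : 0 < r) (hs : sphere μ r ⊆ resolventSet T) (n : ℤ) (y : H) :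
    subScalar T μ ⟨resolventMoment T μ r n y, resolventMoment_mem_domain hr hs n y⟩ =
      resolventMoment T μ r (n + 1) y - if n = -1 then y else 0 := by
  have hw : μ + r ∈ resolventSet T := hs (by simp [abs_of_pos hr])
  have h := congrArg (fun A : H →L[ℂ] H => A y) (resolventMoment_eq hr hs hw n)
  simp only [mul_apply_eq_comp] at h
  have h₂ := apply_resolvent_apply hw ((((μ + r - μ) • resolventMoment T μ r n -
    resolventMoment T μ r (n + 1) + if n = -1 then 1 else 0) : H →L[ℂ] H) y)
  simp only [← h] at h₂
  refine (subScalar_apply T μ _).trans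
    ((congrArg (· - μ • resolventMoment T μ r n y) h₂).trans ?_)
  split_ifs <;> simp <;> module

/-- Cauchy's theorem on the annulus, where the integrand is holomorphic. -/
lemma resolventMoment_eq_of_le {ε : ℝ} (hε : 0 < ε) (hle : ε ≤ r)
    (hs : closedBall μ r \ {μ} ⊆ resolventSet T) (n : ℤ) :
    resolventMoment T μ r n = resolventMoment T μ ε n := by
  rw [resolventMoment, resolventMoment]
  congr 1
  refine Complex.circleIntegral_eq_of_differentiable_on_annulus_off_countable hε hle
    Set.countable_empty ?_ ?_
  · refine continuousOn_zpow_smul_resolvent n (fun z hz => hs ⟨hz.1, ?_⟩) (by simp [hε])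
    rintro rfl
    exact hz.2 (mem_ball_self hε)
  · rintro z ⟨⟨hz, hz'⟩, -⟩
    have hzμ : z ≠ μ := by
      rintro rfl
      exact hz' (mem_closedBall_self hε.le)
    have hmem : resolventSet T ∈ 𝓝 z := by
      filter_upwards [isOpen_ball.mem_nhds hz, isOpen_ne.mem_nhds hzμ] with x hx hx'
      exact hs ⟨ball_subset_closedBall hx, hx'⟩
    have hpow : DifferentiableAt ℂ (fun z : ℂ => (z - μ) ^ n) z :=
      (differentiableAt_id.sub_const μ).zpow (Or.inl (sub_ne_zero.2 hzμ))
    exact hpow.smul ((differentiableOn_resolvent T).differentiableAt hmem)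

lemma exists_norm_resolventMoment_le {ε : ℝ} (hε : 0 < ε) (hle : ε ≤ r)
    (hs : closedBall μ r \ {μ} ⊆ resolventSet T) :
    ∃ C : ℝ, ∀ n : ℕ, ‖resolventMoment T μ r n‖ ≤ C * ε ^ n := by
  have hsub : sphere μ ε ⊆ resolventSet T := fun z hz =>
    hs ⟨closedBall_subset_closedBall hle (sphere_subset_closedBall hz), fun h => by
      rw [Set.mem_singleton_iff] at h
      simp [h, hε.ne] at hz⟩
  obtain ⟨M, hM⟩ := (isCompact_sphere μ ε).exists_bound_of_continuousOn
    (continuousOn_resolvent_sphere hsub)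
  -- `M` bounds the resolvent on the circle of radius `ε`; the extra `ε` is its length over `2π`.
  refine ⟨ε * M, fun n => ?_⟩
  rw [resolventMoment_eq_of_le hε hle hs, resolventMoment, mul_assoc ε, mul_comm M]
  refine circleIntegral.norm_two_pi_i_inv_smul_integral_le_of_norm_le_const hε.le fun z hz => ?_
  rw [norm_smul, zpow_natCast, norm_pow, mem_sphere_iff_norm.1 hz]
  exact mul_le_mul_of_nonneg_left (hM z hz) (by positivity)

end Moments

/-- A log-convex sequence of nonnegative numbers with `a 1 ≠ 0` grows at least geometrically. -/
lemma exists_geometric_le_of_sq_le_mul {a : ℕ → ℝ} (h₀ : ∀ n, 0 ≤ a n)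
    (h : ∀ n, a (n + 1) ^ 2 ≤ a (n + 2) * a n) (h₁ : a 1 ≠ 0) :
    ∃ c > 0, ∃ q > 0, ∀ n, c * q ^ n ≤ a n := by
  have ha₁ : 0 < a 1 := (h₀ 1).lt_of_ne' h₁
  have ha₀ : 0 < a 0 := by
    refine (h₀ 0).lt_of_ne' fun h' => ?_
    have := h 0
    rw [h', mul_zero] at this
    nlinarith
  have hq : 0 < a 1 / a 0 := div_pos ha₁ ha₀
  -- The ratios `a (n + 1) / a n` do not decrease; positivity is carried along to cancel `a n`.
  have step : ∀ n, 0 < a n ∧ a 1 / a 0 * a n ≤ a (n + 1) := by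
    intro n
    induction n with
    | zero => exact ⟨ha₀, by rw [zero_add, div_mul_cancel₀ _ ha₀.ne']⟩
    | succ n ih =>
      have hpos : 0 < a (n + 1) := (mul_pos hq ih.1).trans_le ih.2
      refine ⟨hpos, le_of_mul_le_mul_right ?_ ih.1⟩
      calc a 1 / a 0 * a (n + 1) * a n = a 1 / a 0 * a n * a (n + 1) := by ring
        _ ≤ a (n + 1) * a (n + 1) := mul_le_mul_of_nonneg_right ih.2 hpos.le
        _ = a (n + 1) ^ 2 := (sq _).symm
        _ ≤ a (n + 2) * a n := h n
  refine ⟨a 0, ha₀, a 1 / a 0, hq, fun n => ?_⟩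
  induction n with
  | zero => simp
  | succ n ih =>
    calc a 0 * (a 1 / a 0) ^ (n + 1) = a 1 / a 0 * (a 0 * (a 1 / a 0) ^ n) := by ring
      _ ≤ a 1 / a 0 * a n := mul_le_mul_of_nonneg_left ih hq.le
      _ ≤ a (n + 1) := (step n).2

/-! ### Paranormality and the kernel of the Riesz projection -/

section Paranormal

variable {H : Type*} [NormedAddCommGroup H] [InnerProductSpace ℂ H]
  {T : H →ₗ.[ℂ] H} {μ : ℂ} {r : ℝ}

lemma sphere_subset_resolventSet (hr : 0 < r) (hs : closedBall μ r \ {μ} ⊆ resolventSet T) :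
    sphere μ r ⊆ resolventSet T := fun z hz =>
  hs ⟨sphere_subset_closedBall hz, fun h => by
    rw [Set.mem_singleton_iff] at h
    simp [h, hr.ne] at hz⟩

variable [CompleteSpace H]

/-- If `T - μ` is paranormal, it vanishes on the range of the Riesz projection at `μ`. -/
lemma resolventMoment_one_eq_zero (hr : 0 < r) (hs : closedBall μ r \ {μ} ⊆ resolventSet T)
    (hpara : IsParanormal (subScalar T μ)) : resolventMoment T μ r 1 = 0 := by
  have hsph := sphere_subset_resolventSet hr hs
  ext y
  by_contra hy
  have hmoment : ∀ n : ℕ, subScalar T μ ⟨resolventMoment T μ r n y,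
      resolventMoment_mem_domain hr hsph n y⟩ = resolventMoment T μ r (n + 1 : ℕ) y := by
    intro n
    rw [subScalar_resolventMoment hr hsph, if_neg (by omega), sub_zero, Nat.cast_add_one]
  obtain ⟨c, hc, q, hq, hcq⟩ := exists_geometric_le_of_sq_le_mul
    (a := fun n : ℕ => ‖resolventMoment T μ r n y‖) (fun n => norm_nonneg _)
    (fun n => by
      have h := hpara ⟨resolventMoment T μ r n y, resolventMoment_mem_domain hr hsph n y⟩
        (by rw [hmoment]; exact resolventMoment_mem_domain hr hsph _ y)
      simpa only [hmoment] using h)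
    (by simpa using hy)
  -- A radius inside the disc and at most `q / 2`, so the two bounds differ by a factor `2ⁿ`.
  have hε : 0 < min r (q / 2) := lt_min hr (by positivity)
  obtain ⟨C, hC⟩ := exists_norm_resolventMoment_le hε (min_le_left _ _) hs
  have hC₀ : 0 ≤ C := by simpa using (norm_nonneg _).trans (hC 0)
  obtain ⟨n, hn⟩ := pow_unbounded_of_one_lt (C * ‖y‖ / c) (one_lt_two : (1 : ℝ) < 2)
  have h : c * q ^ n ≤ C * (q / 2) ^ n * ‖y‖ :=
    calc c * q ^ n ≤ ‖resolventMoment T μ r n y‖ := hcq n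
      _ ≤ ‖resolventMoment T μ r n‖ * ‖y‖ := ContinuousLinearMap.le_opNorm _ _
      _ ≤ C * min r (q / 2) ^ n * ‖y‖ := mul_le_mul_of_nonneg_right (hC n) (norm_nonneg _)
      _ ≤ C * (q / 2) ^ n * ‖y‖ := by
        gcongr
        exact min_le_right _ _
  rw [div_lt_iff₀ hc] at hn
  have hqn : 0 < q ^ n := pow_pos hq n
  have h2 : (0 : ℝ) < 2 ^ n := by positivity
  rw [div_pow, mul_div_assoc', div_mul_eq_mul_div, le_div_iff₀ h2] at h
  nlinarith

theorem ker_rieszProjection (hr : 0 < r) (hs : closedBall μ r \ {μ} ⊆ resolventSet T)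
    (hpara : IsParanormal (subScalar T μ)) :
    LinearMap.ker (rieszProjection T μ r : H →ₗ[ℂ] H) = ran (subScalar T μ) := by
  have hsph := sphere_subset_resolventSet hr hs
  have hw : μ + r ∈ resolventSet T := hsph (by simp [abs_of_pos hr])
  rw [← resolventMoment_zero]
  ext y
  simp only [LinearMap.mem_ker, ContinuousLinearMap.coe_coe]
  constructor
  · intro hy
    refine ⟨-⟨_, resolventMoment_mem_domain hr hsph (-1) y⟩, ?_⟩
    have h := subScalar_resolventMoment hr hsph (-1) y
    rw [if_pos rfl, neg_add_cancel, hy, zero_sub] at h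
    exact ((subScalar T μ).map_neg _).trans (by rw [h, neg_neg])
  · rintro ⟨x, rfl⟩
    change resolventMoment T μ r 0 (T x - μ • (x : H)) = 0
    have hx := resolvent_smul_sub_apply hw x
    -- With `w = μ + r`, `x = R(w) h`; `B₁ = 0` gives `E h = (w - μ) R(w) E h`, which is `E (T - μ)
    -- x = 0` after commuting.
    set h := (μ + r) • (x : H) - T x with hh
    have hTx : T x - μ • (x : H) = (μ + r - μ) • resolvent T (μ + r) h - h := by
      rw [hx, hh]
      module
    have hcomm := congrArg (fun A : H →L[ℂ] H => A h) (resolventMoment_commute hr hsph hw 0)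
    have heq := congrArg (fun A : H →L[ℂ] H => A h) (resolventMoment_eq hr hsph hw 0)
    rw [zero_add, resolventMoment_one_eq_zero hr hs hpara] at heq
    simp only [mul_apply_eq_comp] at hcomm heq
    rw [hTx, map_sub, map_smul, hcomm, ← map_smul, sub_eq_zero]
    simpa using heq.symm

end Paranormal

lemma diff_singleton_subset_resolventSet {H : Type*} [NormedAddCommGroup H]
    [InnerProductSpace ℂ H] {T : H →ₗ.[ℂ] H} {μ : ℂ} {s : Set ℂ} (h : s ∩ spectrum T = {μ}) :
    s \ {μ} ⊆ resolventSet T := by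
  rintro z ⟨hz, hzμ⟩
  by_contra hz'
  exact hzμ (h ▸ ⟨hz, hz'⟩)

lemma IsIsolatedPoint.exists_closedBall {s : Set ℂ} {μ : ℂ} (h : IsIsolatedPoint s μ) :
    ∃ r > 0, closedBall μ r ∩ s = {μ} := by
  obtain ⟨hμ, U, hU, hUs⟩ := h
  have hμU : μ ∈ U := (hUs.symm ▸ Set.mem_singleton μ : μ ∈ U ∩ s).1
  obtain ⟨r, hr, hrU⟩ := nhds_basis_closedBall.mem_iff.1 (hU.mem_nhds hμU)
  refine ⟨r, hr, Set.Subset.antisymm ?_ ?_⟩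
  · rw [← hUs]
    exact Set.inter_subset_inter_left _ hrU
  · rintro _ rfl
    exact ⟨mem_closedBall_self hr.le, hμ⟩

end UnboundedOperator

theorem theorem3p5 {H : Type*} [NormedAddCommGroup H] [InnerProductSpace ℂ H] [CompleteSpace H]
    (T : H →ₗ.[ℂ] H) (hdense : Dense (T.domain : Set H)) (hclosed : T.IsClosed)
    (hpara : UnboundedOperator.IsTotallyParanormal T) :
    (∀ μ : ℂ, UnboundedOperator.IsIsolatedPoint (UnboundedOperator.spectrum T) μ →
      ∀ r : ℝ, 0 < r → Metric.closedBall μ r ∩ UnboundedOperator.spectrum T = {μ} →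
        CircleIntegrable (UnboundedOperator.resolvent T) μ r ∧
        LinearMap.ker (UnboundedOperator.rieszProjection T μ r : H →ₗ[ℂ] H) =
          UnboundedOperator.ran (UnboundedOperator.subScalar T μ)) ∧
    (UnboundedOperator.IsIsolatedPoint (UnboundedOperator.spectrum T) 0 →
      IsClosed (UnboundedOperator.ran T : Set H)) := by
  refine ⟨fun μ _ r hr hμr => ?_, fun h₀ => ?_⟩
  · have hs := UnboundedOperator.diff_singleton_subset_resolventSet hμr
    exact ⟨(UnboundedOperator.continuousOn_resolvent_sphere
      (UnboundedOperator.sphere_subset_resolventSet hr hs)).circleIntegrable hr.le,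
      UnboundedOperator.ker_rieszProjection hr hs (hpara μ)⟩
  · obtain ⟨r, hr, h⟩ := h₀.exists_closedBall
    have hker := UnboundedOperator.ker_rieszProjection hr
      (UnboundedOperator.diff_singleton_subset_resolventSet h) (hpara 0)
    have hran : UnboundedOperator.ran (UnboundedOperator.subScalar T 0) =
        UnboundedOperator.ran T := by
      simp [UnboundedOperator.ran, UnboundedOperator.subScalar]
    rw [← hran, ← hker]
    exact ContinuousLinearMap.isClosed_ker _
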